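/- Let $K$ be a field, let $E$ be an algebraic closure of $K$, and let $A$ be an $n\times n$ matrix over $K$. Let $\mathrm{Cen}(A)=\{B\in M_n(K)\mid AB=BA\}$, a unital $K$-subalgebra of $M_n(K)$. Over $E$ the matrix $A$ has a Jordan canonical form, that is, it is similar to a block diagonal matrix whose diagonal blocks are elementary Jordan matrices of positive sizes. Let $p$ be the maximal number of equal elementary Jordan matrices (same size and same eigenvalue) in a Jordan canonical form of $A$ over $E$ (with $p=0$ if $n=0$). Then $$\mathrm{PIdeg}(\mathrm{Cen}(A))=p .$$ Here, for a unital $K$-algebra $S$, $\mathrm{PIdeg}(S)$ denotes the maximal integer $q\ge 0$ such that all multilinear polynomial identities of $S$ follow from the multilinear polynomial identities of the matrix algebra $M_q(K)$. A multilinear polynomial is an element $\sum_{\sigma}c_\sigma x_{\sigma(1)}\cdots x_{\sigma(d)}$ ($d\ge 0$, $c_\sigma\in K$, $\sigma$ running over the permutations of $\{1,\dots,d\}$) of the free unital algebra $K\langle x_1,x_2,\dots\rangle$; it is an identity of $S$ if it vanishes under all substitutions of elements of $S$ for the variables; and an identity follows from a set of identities if it lies in the T-ideal (the two-sided ideal stable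 under all $K$-algebra endomorphisms of $K\langle x_1,x_2,\dots\rangle$) generated by that set. -/

import Mathlib

/-! ### Polynomial identities and the PI-degree

Algebras are associative with `1`.  The free algebra `K⟨x₀, x₁, …⟩` is `FreeAlgebra K ℕ`. -/

/-- `f ∈ K⟨x₀, x₁, …⟩` is a polynomial identity of the `K`-algebra `S`: it vanishes under every
substitution of elements of `S` for the variables. -/
def IsPolynomialIdentity (K : Type*) [Field K] (S : Type*) [Ring S] [Algebra K S]
    (f : FreeAlgebra K ℕ) : Prop :=
  ∀ a : ℕ → S, FreeAlgebra.lift K a f = 0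

/-- `f` is multilinear: for some `d` it is a `K`-linear combination of the monomials
`x_{σ(0)} x_{σ(1)} ⋯ x_{σ(d-1)}`, where `σ` runs over the permutations of `{0, …, d-1}`. -/
def IsMultilinearPolynomial (K : Type*) [Field K] (f : FreeAlgebra K ℕ) : Prop :=
  ∃ (d : ℕ) (c : Equiv.Perm (Fin d) → K),
    f = ∑ σ : Equiv.Perm (Fin d),
      c σ • (List.ofFn fun i : Fin d => FreeAlgebra.ι K ((σ i : Fin d) : ℕ)).prod

/-- The set of multilinear polynomial identities of `S`. -/
def multilinearIdentities (K : Type*) [Field K] (S : Type*) [Ring S] [Algebra K S] :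
    Set (FreeAlgebra K ℕ) :=
  {f | IsMultilinearPolynomial K f ∧ IsPolynomialIdentity K S f}

/-- A T-ideal of `K⟨x₀, x₁, …⟩`: a two-sided ideal that is stable under all `K`-algebra
endomorphisms of the free algebra. -/
def IsTIdeal (K : Type*) [Field K] (I : TwoSidedIdeal (FreeAlgebra K ℕ)) : Prop :=
  ∀ (φ : FreeAlgebra K ℕ →ₐ[K] FreeAlgebra K ℕ), ∀ g ∈ I, φ g ∈ I

/-- The identity `f` follows from the identities in `F`: it lies in the T-ideal generated by `F`,
that is, in every T-ideal that contains `F`. -/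
def FollowsFrom (K : Type*) [Field K] (F : Set (FreeAlgebra K ℕ)) (f : FreeAlgebra K ℕ) : Prop :=
  ∀ I : TwoSidedIdeal (FreeAlgebra K ℕ), IsTIdeal K I → (∀ g ∈ F, g ∈ I) → f ∈ I

/-- `PIdeg(S) = p`: `p` is the maximal natural number such that the multilinear polynomial
identities of `S` follow from the multilinear polynomial identities of the matrix algebra
`M_p(K)`. -/
def IsPIDegree (K : Type*) [Field K] (S : Type*) [Ring S] [Algebra K S] (p : ℕ) : Prop :=
  IsGreatest
    {q : ℕ | ∀ f ∈ multilinearIdentities K S,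
      FollowsFrom K (multilinearIdentities K (Matrix (Fin q) (Fin q) K)) f} p

/-! ### The Jordan canonical form -/

/-- The elementary Jordan matrix of size `k` with eigenvalue `μ`: `μ` on the diagonal, `1` on the
first superdiagonal, `0` elsewhere. -/
def elementaryJordanMatrix {E : Type*} [Field E] (μ : E) (k : ℕ) : Matrix (Fin k) (Fin k) E :=
  Matrix.of fun i j => if i = j then μ else if (i : ℕ) + 1 = (j : ℕ) then 1 else 0

/-- The data of a Jordan matrix over `E`: a finite sequence of blocks, each with a positive size
and an eigenvalue. -/
structure JordanData (E : Type*) where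
  /-- the number of blocks -/
  numBlocks : ℕ
  /-- the sizes of the blocks -/
  size : Fin numBlocks → ℕ
  size_pos : ∀ b, 0 < size b
  /-- the eigenvalues of the blocks -/
  eigenvalue : Fin numBlocks → E

/-- The block diagonal matrix of elementary Jordan matrices given by `J`. -/
def JordanData.toMatrix {E : Type*} [Field E] (J : JordanData E) :
    Matrix (Σ b : Fin J.numBlocks, Fin (J.size b)) (Σ b : Fin J.numBlocks, Fin (J.size b)) E :=
  Matrix.blockDiagonal' fun b => elementaryJordanMatrix (J.eigenvalue b) (J.size b)

/-- `J` is a Jordan canonical form of the `n × n` matrix `B` over `E`: `B` is similar to the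
Jordan matrix of `J`.  The change of basis `P` and its inverse `Q` have one side indexed by
`Fin n` and the other by the positions in the blocks. -/
def JordanData.IsJordanFormOf {E : Type*} [Field E] (J : JordanData E) {n : ℕ}
    (B : Matrix (Fin n) (Fin n) E) : Prop :=
  ∃ (P : Matrix (Fin n) (Σ b : Fin J.numBlocks, Fin (J.size b)) E)
    (Q : Matrix (Σ b : Fin J.numBlocks, Fin (J.size b)) (Fin n) E),
    P * Q = 1 ∧ Q * P = 1 ∧ Q * B * P = J.toMatrix

open Classical in
/-- The maximal number of equal blocks (same size and same eigenvalue) in `J`; it is `0` if `J` has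
no blocks at all. -/
noncomputable def JordanData.maxEqualBlocks {E : Type*} (J : JordanData E) : ℕ :=
  Finset.univ.sup fun b : Fin J.numBlocks =>
    (Finset.univ.filter fun c : Fin J.numBlocks =>
      J.size c = J.size b ∧ J.eigenvalue c = J.eigenvalue b).card

/-! ### The PI-degree as an inclusion of identities -/

section PIDegree

variable {K : Type*} [Field K]

/-! The identities of an algebra form a T-ideal, so the condition on `q` says that every multilinear
identity of Cen(A) holds in M_q(K). Over `E`, Cen(A) spans a conjugate of the commutant C of the
Jordan matrix, and both have the same multilinear identities over `K` (`isPolynomialIdentity_iff`).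

For a block type (size and eigenvalue) of multiplicity r, the entries of C at the first positions of
these blocks give a surjection C → M_r(E) (`headHom`). The common kernel of these maps is nilpotent,
since it is strictly triangular for `weight`.

A type of multiplicity p shows that the identities hold in M_p(E), hence in M_p(K). Conversely, a
Capelli polynomial alternating in p² + 1 variables vanishes on each M_r(E) with r ≤ p, by dimension.
Its values on C thus lie in the kernel, and a product of enough copies in disjoint variables is a
multilinear identity of C. It fails in M_q(K) for q > p, where there are at least p² + 1 matrix
units (`capelliProduct_not_identity`). -/

theorem followsFrom_multilinearIdentities_iff {S R : Type*} [Ring S] [Algebra K S] [Ring R]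
    [Algebra K R] :
    (∀ f ∈ multilinearIdentities K S, FollowsFrom K (multilinearIdentities K R) f) ↔
      ∀ f ∈ multilinearIdentities K S, IsPolynomialIdentity K R f := by
  refine ⟨fun h f hf a => ?_, fun h f hf I _ hI => hI f ⟨hf.1, h f hf⟩⟩
  let I : TwoSidedIdeal (FreeAlgebra K ℕ) :=
    ⨅ a : ℕ → R, TwoSidedIdeal.ker (FreeAlgebra.lift K a)
  have hI : ∀ g, g ∈ I ↔ IsPolynomialIdentity K R g := fun g => by
    simp [I, TwoSidedIdeal.mem_iInf, TwoSidedIdeal.mem_ker, IsPolynomialIdentity]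
  refine (hI f).1 (h f hf I (fun φ g hg => (hI _).2 fun b => ?_) fun g hg => (hI g).2 hg.2) a
  have : FreeAlgebra.lift K b (φ g) =
      FreeAlgebra.lift K (fun i => FreeAlgebra.lift K b (φ (FreeAlgebra.ι K i))) g := by
    rw [← AlgHom.comp_apply]
    congr 1
    ext i
    simp
  rw [this]
  exact (hI g).1 hg _

theorem lift_algHom_apply {X S R : Type*} [Ring S] [Algebra K S] [Ring R] [Algebra K R]
    (φ : S →ₐ[K] R) (a : X → S) (f : FreeAlgebra K X) :
    FreeAlgebra.lift K (fun i => φ (a i)) f = φ (FreeAlgebra.lift K a f) := by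
  rw [← AlgHom.comp_apply]
  congr 1
  ext i
  simp

end PIDegree

/-! ### Multilinear monomials -/

section Monomials

variable (K : Type*) [Field K]

/-- The monomial `x_{l₀} x_{l₁} ⋯` given by a list of indices. -/
noncomputable def freeMonomial (l : List ℕ) : FreeAlgebra K ℕ :=
  (l.map (FreeAlgebra.ι K)).prod

/-- The span of the monomials in which the variables of `L` occur, each as often as in `L`. -/
noncomputable def multilinearSpan (L : List ℕ) : Submodule K (FreeAlgebra K ℕ) :=
  Submodule.span K (freeMonomial K '' {l | l.Perm L})

variable {K}

theorem freeMonomial_mem_multilinearSpan {l L : List ℕ} (h : l.Perm L) :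
    freeMonomial K l ∈ multilinearSpan K L :=
  Submodule.subset_span (Set.mem_image_of_mem _ h)

theorem isMultilinearPolynomial_of_mem_span {d : ℕ} {f : FreeAlgebra K ℕ}
    (hf : f ∈ multilinearSpan K (List.range d)) : IsMultilinearPolynomial K f := by
  let M : Equiv.Perm (Fin d) → FreeAlgebra K ℕ := fun σ =>
    (List.ofFn fun i : Fin d => FreeAlgebra.ι K ((σ i : Fin d) : ℕ)).prod
  have key : multilinearSpan K (List.range d) ≤ Submodule.span K (Set.range M) := by
    refine Submodule.span_mono ?_
    rintro _ ⟨l, hl, rfl⟩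
    have hl : l.Perm (List.range d) := hl
    have hlen : l.length = d := by simpa using hl.length_eq
    have hnd : l.Nodup := hl.nodup_iff.2 List.nodup_range
    subst hlen
    -- A list without repetition that rearranges `0, …, d - 1` is itself the table of values of a
    -- permutation.
    let g : Fin l.length → Fin l.length := fun i =>
      ⟨l.get i, by simpa using hl.subset (List.get_mem l i)⟩
    have hg : Function.Injective g := fun i j h =>
      hnd.injective_get (by simpa [g] using congrArg Fin.val h)
    refine ⟨Equiv.ofBijective g (Finite.injective_iff_bijective.1 hg), ?_⟩
    simp only [M, freeMonomial, Equiv.ofBijective_apply, g]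
    congr 1
    conv_rhs => rw [← List.ofFn_get l, List.map_ofFn]
    rfl
  obtain ⟨c, hc⟩ := (Submodule.mem_span_range_iff_exists_fun K).1 (key hf)
  exact ⟨d, c, hc.symm⟩

theorem mul_mem_multilinearSpan {L L' : List ℕ} {f g : FreeAlgebra K ℕ}
    (hf : f ∈ multilinearSpan K L) (hg : g ∈ multilinearSpan K L') :
    f * g ∈ multilinearSpan K (L ++ L') := by
  have := Submodule.mul_mem_mul hf hg
  rw [multilinearSpan, multilinearSpan, Submodule.span_mul_span] at this
  refine Submodule.span_mono ?_ this
  rintro _ ⟨_, ⟨l, hl, rfl⟩, _, ⟨l', hl', rfl⟩, rfl⟩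
  exact ⟨l ++ l', List.Perm.append hl hl', by simp [freeMonomial]⟩

theorem lift_freeMonomial {S : Type*} [Ring S] [Algebra K S] (a : ℕ → S) (l : List ℕ) :
    FreeAlgebra.lift K a (freeMonomial K l) = (l.map a).prod := by
  simp only [freeMonomial, map_list_prod, List.map_map]
  congr 2
  ext i
  simp

end Monomials

/-! ### Capelli polynomials and their products -/

section Capelli

/-- The indices of the monomial `∏ᵢ zᵢ x_{σ i} yᵢ`, the variables `zᵢ`, `xᵢ`, `yᵢ` being those with
the indices `s + 3i`, `s + 3i + 1`, `s + 3i + 2`. -/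
def capelliList (m s : ℕ) (σ : Equiv.Perm (Fin m)) : List ℕ :=
  (List.finRange m).flatMap fun i : Fin m =>
    [s + 3 * (i : ℕ), s + 3 * (σ i : ℕ) + 1, s + 3 * (i : ℕ) + 2]

theorem capelliList_perm (m s : ℕ) (σ : Equiv.Perm (Fin m)) :
    (capelliList m s σ).Perm (List.range' s (3 * m)) := by
  have h1 : (capelliList m s σ).Perm (capelliList m s 1) := by
    -- Once the three kinds of variables are sorted apart, the permutation only reorders the middle
    -- kind.
    have key : ∀ τ : Equiv.Perm (Fin m), (capelliList m s τ).Perm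
        ((List.finRange m).flatMap (fun i : Fin m => [s + 3 * (i : ℕ)]) ++
          (((List.finRange m).map τ).map (fun i : Fin m => s + 3 * (i : ℕ) + 1) ++
          (List.finRange m).flatMap (fun i : Fin m => [s + 3 * (i : ℕ) + 2]))) := fun τ => by
      have e : ((List.finRange m).map τ).map (fun i : Fin m => s + 3 * (i : ℕ) + 1) =
          (List.finRange m).flatMap (fun i : Fin m => [s + 3 * (τ i : ℕ) + 1]) := by
        rw [List.map_map, ← List.flatMap_pure_eq_map]
        rfl
      rw [e]
      refine List.Perm.trans ?_ (List.Perm.append_left _ (List.flatMap_append_perm _ _ _).symm)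
      exact (List.flatMap_append_perm _ (fun i : Fin m => [s + 3 * (i : ℕ)])
        (fun i : Fin m => [s + 3 * (τ i : ℕ) + 1] ++ [s + 3 * (i : ℕ) + 2])).symm
    refine (key σ).trans (List.Perm.trans ?_ (key 1).symm)
    refine List.Perm.append_left _ (List.Perm.append_right _ (List.Perm.map _ ?_))
    refine List.perm_of_nodup_nodup_toFinset_eq ?_ ?_ ?_
    · exact (List.nodup_finRange m).map σ.injective
    · exact (List.nodup_finRange m).map (Equiv.injective _)
    · ext i
      simpa using σ.surjective i
  refine h1.trans (List.Perm.of_eq ?_)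
  clear h1 σ
  induction m with
  | zero => simp [capelliList]
  | succ m ih =>
    have : capelliList (m + 1) s 1 = capelliList m s 1 ++ [s + 3 * m, s + 3 * m + 1, s + 3 * m + 2] := by
      simp [capelliList, List.finRange_succ_last, List.flatMap_append, List.flatMap_map]
    rw [this, ih, show 3 * (m + 1) = 3 * m + 3 by ring, ← List.range'_append]
    simp [List.range']

variable (K : Type*) [Field K]

/-- The polynomial `∑_σ sgn(σ) ∏ᵢ zᵢ x_{σ i} yᵢ` in `3m` variables, from the index `s` on. -/
noncomputable def capelliPolynomial (m s : ℕ) : FreeAlgebra K ℕ :=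
  ∑ σ : Equiv.Perm (Fin m), Equiv.Perm.sign σ • freeMonomial K (capelliList m s σ)

/-- The product of `k` copies of `capelliPolynomial` in disjoint sets of variables. -/
noncomputable def capelliProduct (m : ℕ) : ℕ → FreeAlgebra K ℕ
  | 0 => 1
  | k + 1 => capelliProduct m k * capelliPolynomial K m (3 * m * k)

variable {K}

theorem capelliPolynomial_mem_multilinearSpan (m s : ℕ) :
    capelliPolynomial K m s ∈ multilinearSpan K (List.range' s (3 * m)) := by
  refine Submodule.sum_mem _ fun σ _ => ?_
  have h := freeMonomial_mem_multilinearSpan (K := K) (capelliList_perm m s σ)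
  rcases Int.units_eq_one_or (Equiv.Perm.sign σ) with h1 | h1
  · rwa [h1, one_smul]
  · rw [h1, Units.neg_smul, one_smul]
    exact Submodule.neg_mem _ h

theorem isMultilinearPolynomial_capelliProduct (m k : ℕ) :
    IsMultilinearPolynomial K (capelliProduct K m k) := by
  refine isMultilinearPolynomial_of_mem_span (d := 3 * m * k) ?_
  induction k with
  | zero =>
    have h1 : capelliProduct K m 0 = freeMonomial K [] := by simp [freeMonomial, capelliProduct]
    rw [h1]
    exact freeMonomial_mem_multilinearSpan (List.Perm.refl _)
  | succ k ih =>
    have := mul_mem_multilinearSpan ih (capelliPolynomial_mem_multilinearSpan m (3 * m * k))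
    rw [List.range_eq_range', show List.range' (3 * m * k) (3 * m) =
      List.range' (0 + 3 * m * k) (3 * m) by simp, List.range'_append_1] at this
    rwa [List.range_eq_range', mul_add, mul_one]

theorem lift_capelliPolynomial {S : Type*} [Ring S] [Algebra K S] (a : ℕ → S) (m s : ℕ) :
    FreeAlgebra.lift K a (capelliPolynomial K m s) = ∑ σ : Equiv.Perm (Fin m),
      Equiv.Perm.sign σ • (List.ofFn fun i : Fin m =>
        a (s + 3 * i) * a (s + 3 * (σ i : ℕ) + 1) * a (s + 3 * i + 2)).prod := by
  simp only [capelliPolynomial, map_sum, Units.smul_def, map_zsmul, lift_freeMonomial]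
  refine Finset.sum_congr rfl fun σ _ => ?_
  congr 1
  rw [capelliList, List.ofFn_eq_map]
  induction List.finRange m with
  | nil => simp
  | cons i l ih => simp [ih, mul_assoc]

/-- The value is alternating and `E`-multilinear in the `m` middle arguments, which are linearly
dependent over `E`. The outer variables keep their places and act as constants. -/
theorem lift_capelliPolynomial_eq_zero (E : Type*) [Field E] {S : Type*} [Ring S] [Algebra K S]
    [Algebra E S] [FiniteDimensional E S] {m : ℕ} (hm : Module.finrank E S < m) (a : ℕ → S)
    (s : ℕ) : FreeAlgebra.lift K a (capelliPolynomial K m s) = 0 := by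
  let F : MultilinearMap E (fun _ : Fin m => S) S :=
    (MultilinearMap.mkPiAlgebraFin E m S).compLinearMap fun i =>
      LinearMap.mulRight E (a (s + 3 * i + 2)) ∘ₗ LinearMap.mulLeft E (a (s + 3 * i))
  have h0 : MultilinearMap.alternatization F (fun i => a (s + 3 * i + 1)) = 0 := by
    refine AlternatingMap.map_linearDependent _ _ fun h => ?_
    have := h.fintype_card_le_finrank
    simp only [Fintype.card_fin] at this
    omega
  rw [lift_capelliPolynomial, ← h0, MultilinearMap.alternatization_apply]
  refine Finset.sum_congr rfl fun σ _ => ?_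
  simp [F]

/-- The middle variables become distinct matrix units, and the outer ones carry `o` to the row and
the column of the `i`-th unit. A factor with `σ i ≠ i` is then zero, so only the identity
permutation survives. -/
theorem capelliProduct_not_identity {q m : ℕ} (hm : m ≤ q ^ 2) (hq : 0 < q) (k : ℕ) :
    ¬ IsPolynomialIdentity K (Matrix (Fin q) (Fin q) K) (capelliProduct K m k) := by
  intro h
  let o : Fin q := ⟨0, hq⟩
  obtain ⟨x⟩ : Nonempty (Fin m ↪ Fin q × Fin q) :=
    Function.Embedding.nonempty_of_card_le (by simpa [sq] using hm)
  -- All copies use the same `m` units; the default value occurs only for `m = 0`.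
  let y : ℕ → Fin q × Fin q := fun n => if hn : n % m < m then x ⟨n % m, hn⟩ else (o, o)
  let a : ℕ → Matrix (Fin q) (Fin q) K := fun n =>
    if n % 3 = 0 then Matrix.single o (y (n / 3)).1 1
    else if n % 3 = 1 then Matrix.single (y (n / 3)).1 (y (n / 3)).2 1
    else Matrix.single (y (n / 3)).2 o 1
  have hy : ∀ (t : ℕ) (i : Fin m), y (m * t + i) = x i := fun t i => by
    have : (m * t + i) % m = i := by rw [Nat.mul_add_mod, Nat.mod_eq_of_lt i.2]
    simp [y, this]
  -- Only column `o` is described: for `m = 0` the value is the identity matrix, not the unit at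
  -- `(o, o)`.
  have hval : ∀ t, FreeAlgebra.lift K a (capelliPolynomial K m (3 * m * t)) o o = 1 ∧
      ∀ i ≠ o, FreeAlgebra.lift K a (capelliPolynomial K m (3 * m * t)) i o = 0 := by
    intro t
    have hterm : ∀ i j : Fin m, a (3 * m * t + 3 * i) * a (3 * m * t + 3 * (j : ℕ) + 1) *
        a (3 * m * t + 3 * i + 2) = if j = i then Matrix.single o o 1 else 0 := by
      intro i j
      have h0 : a (3 * m * t + 3 * i) = Matrix.single o (x i).1 1 := by
        have e : (3 * m * t + 3 * (i : ℕ)) / 3 = m * t + i := by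
          rw [mul_assoc]; omega
        have e' : (3 * m * t + 3 * (i : ℕ)) % 3 = 0 := by
          rw [mul_assoc]; omega
        simp only [a, e, e', hy, if_true]
      have h1 : a (3 * m * t + 3 * j + 1) = Matrix.single (x j).1 (x j).2 1 := by
        have e : (3 * m * t + 3 * (j : ℕ) + 1) / 3 = m * t + j := by
          rw [mul_assoc]; omega
        have e' : (3 * m * t + 3 * (j : ℕ) + 1) % 3 = 1 := by
          rw [mul_assoc]; omega
        simp [a, e, e', hy]
      have h2 : a (3 * m * t + 3 * i + 2) = Matrix.single (x i).2 o 1 := by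
        have e : (3 * m * t + 3 * (i : ℕ) + 2) / 3 = m * t + i := by
          rw [mul_assoc]; omega
        have e' : (3 * m * t + 3 * (i : ℕ) + 2) % 3 = 2 := by
          rw [mul_assoc]; omega
        simp [a, e, e', hy]
      rw [h0, h1, h2]
      split_ifs with hij
      · subst hij
        simp
      · by_cases h1 : (x i).1 = (x j).1
        · have h2 : (x j).2 ≠ (x i).2 := fun h2 => hij (x.injective (Prod.ext h1.symm h2))
          rw [h1, Matrix.single_mul_single_same, Matrix.single_mul_single_of_ne _ _ _ _ h2]
        · rw [Matrix.single_mul_single_of_ne _ _ _ _ h1, zero_mul]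
    rw [lift_capelliPolynomial, Finset.sum_eq_single 1]
    · simp only [hterm, Equiv.Perm.coe_one, id, if_true, List.ofFn_const, List.prod_replicate,
        Equiv.Perm.sign_one, one_smul]
      rcases m with _ | m
      · exact ⟨by simp, fun i hi => by simp [hi]⟩
      · have : (Matrix.single o o (1 : K)) ^ (m + 1) = Matrix.single o o 1 :=
          IsIdempotentElem.pow_succ_eq m (by simp [IsIdempotentElem])
        rw [this]
        exact ⟨by simp, fun i hi => by simp [hi.symm]⟩
    · intro σ _ hσ
      obtain ⟨i, hi⟩ : ∃ i, σ i ≠ i := by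
        by_contra! h
        exact hσ (Equiv.ext h)
      rw [List.prod_eq_zero, smul_zero]
      rw [List.mem_ofFn]
      exact ⟨i, by rw [hterm, if_neg hi]⟩
    · simp
  have : ∀ k, FreeAlgebra.lift K a (capelliProduct K m k) o o = 1 := by
    intro k
    induction k with
    | zero => simp [capelliProduct]
    | succ k ih =>
      rw [capelliProduct, map_mul, Matrix.mul_apply, Finset.sum_eq_single o, ih, (hval k).1, one_mul]
      · intro i _ hi
        rw [(hval k).2 i hi, mul_zero]
      · simp
  simpa [h a] using this k

end Capelli

/-! ### Intertwiners of two elementary Jordan matrices -/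

section JordanCommutant

section Entries

variable {E : Type*} [Field E]

theorem elementaryJordanMatrix_mulVec_apply (μ : E) {s : ℕ} (f : Fin s → E) (i : Fin s) :
    ∑ k, elementaryJordanMatrix μ s i k * f k =
      μ * f i + if h : (i : ℕ) + 1 < s then f ⟨i + 1, h⟩ else 0 := by
  have : ∀ k, elementaryJordanMatrix μ s i k * f k =
      (if i = k then μ * f k else 0) + if (i : ℕ) + 1 = k then f k else 0 := fun k => by
    by_cases h : i = k
    · simp [elementaryJordanMatrix, h]
    · simp [elementaryJordanMatrix, h]
  simp only [this, Finset.sum_add_distrib, Finset.sum_ite_eq, Finset.mem_univ, if_true]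
  congr 1
  split_ifs with h
  · rw [Finset.sum_eq_single ⟨i + 1, h⟩]
    · simp
    · intro k _ hk
      rw [if_neg fun h' => hk (Fin.ext h'.symm)]
    · simp
  · exact Finset.sum_eq_zero fun k _ => if_neg (by have := k.2; omega)

theorem elementaryJordanMatrix_vecMul_apply (μ : E) {s : ℕ} (f : Fin s → E) (j : Fin s) :
    ∑ k, f k * elementaryJordanMatrix μ s k j =
      f j * μ + if 0 < (j : ℕ) then f ⟨j - 1, by omega⟩ else 0 := by
  have : ∀ k, f k * elementaryJordanMatrix μ s k j =
      (if k = j then f k * μ else 0) + if (k : ℕ) + 1 = j then f k else 0 := fun k => by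
    by_cases h : k = j
    · simp [elementaryJordanMatrix, h]
    · simp [elementaryJordanMatrix, h]
  simp only [this, Finset.sum_add_distrib, Finset.sum_ite_eq', Finset.mem_univ, if_true]
  congr 1
  split_ifs with h
  · rw [Finset.sum_eq_single ⟨j - 1, by omega⟩]
    · rw [if_pos (show (j : ℕ) - 1 + 1 = j by omega)]
    · intro k _ hk
      rw [if_neg fun h' => hk (Fin.ext (show (k : ℕ) = j - 1 by omega))]
    · simp
  · exact Finset.sum_eq_zero fun k _ => if_neg (by omega)

/-- The two-index sequence `x` vanishes outside of `s × t` and describes an intertwiner between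
elementary Jordan matrices of sizes `t` and `s`, with eigenvalues `μ` and `ν`. -/
structure IsJordanIntertwiner (s t : ℕ) (ν μ : E) (x : ℕ → ℕ → E) : Prop where
  eq_zero : ∀ i j, ¬ (i < s ∧ j < t) → x i j = 0
  rel : ∀ i j, i < s → j < t →
    ν * x i j + x (i + 1) j = x i j * μ + if 0 < j then x i (j - 1) else 0

namespace IsJordanIntertwiner

variable {s t : ℕ} {ν μ : E} {x : ℕ → ℕ → E}

/-- Up to sign, `(ν - μ) * x i j` is the difference of the entries below and to the left, for both
of which `j + (s - i)` is smaller. -/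
theorem eq_zero_of_ne (h : IsJordanIntertwiner s t ν μ x) (hne : ν ≠ μ) (i j : ℕ) :
    x i j = 0 := by
  induction hN : j + (s - i) using Nat.strong_induction_on generalizing i j with
  | _ N ih =>
    by_cases hij : i < s ∧ j < t
    · have h1 : x (i + 1) j = 0 := ih _ (by omega) _ _ rfl
      have h2 : (if 0 < j then x i (j - 1) else 0) = 0 := by
        split_ifs with hj
        · exact ih _ (by omega) _ _ rfl
        · rfl
      have := h.rel i j hij.1 hij.2
      rw [h1, h2] at this
      have : (ν - μ) * x i j = 0 := by linear_combination this
      exact (mul_eq_zero.1 this).resolve_left (sub_ne_zero.2 hne)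
    · exact h.eq_zero i j hij

variable (h : IsJordanIntertwiner s t μ μ x)
include h

/-- The matrix is constant along diagonals. The case `i + 1 = s` is included and forces zeros in the
last row. -/
theorem shift {i j : ℕ} (hi : i < s) (hj : j + 1 < t) : x (i + 1) (j + 1) = x i j := by
  have := h.rel i (j + 1) hi hj
  simp only [Nat.succ_pos, if_true, Nat.add_sub_cancel] at this
  linear_combination this

/-- Going up, the diagonal meets column `0` below the first row, where the relation at `j = 0` gives
zero. -/
theorem eq_zero_of_lt {i j : ℕ} (hij : j < i) : x i j = 0 := by
  by_cases hst : i < s ∧ j < t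
  · obtain ⟨i, rfl⟩ : ∃ k, i = k + 1 := ⟨i - 1, by omega⟩
    induction j generalizing i with
    | zero =>
      have := h.rel i 0 (by omega) hst.2
      simp only [lt_irrefl, if_false] at this
      linear_combination this
    | succ j ih =>
      rw [h.shift (by omega) hst.2]
      obtain ⟨i, rfl⟩ : ∃ k, i = k + 1 := ⟨i - 1, by omega⟩
      exact ih i (by omega) (by omega)
  · exact h.eq_zero i j hst

/-- Going down, the diagonal leaves through row `s` before the columns run out. -/
theorem eq_zero_of_add_lt {i j : ℕ} (hij : s + j < t + i) : x i j = 0 := by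
  induction hN : s - i generalizing i j with
  | zero => exact h.eq_zero _ _ (by omega)
  | succ N ih =>
    rw [← h.shift (by omega) (by omega)]
    exact ih (by omega) (by omega)

theorem diag {i : ℕ} (hs : i < s) (ht : i < t) : x i i = x 0 0 := by
  induction i with
  | zero => rfl
  | succ i ih => rw [h.shift (by omega) ht, ih (by omega) (by omega)]

end IsJordanIntertwiner

end Entries

/-! ### The commutant: multiplicity spaces and nilpotent kernel -/

namespace JordanData

variable {E : Type*} [Field E] (J : JordanData E)

/-- The positions in the blocks of `J`. -/
abbrev Pos : Type := Σ b : Fin J.numBlocks, Fin (J.size b)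

variable {J}

theorem toMatrix_mul_apply (B : Matrix J.Pos J.Pos E) (b : Fin J.numBlocks) (i : Fin (J.size b))
    (q : J.Pos) :
    (J.toMatrix * B) ⟨b, i⟩ q = J.eigenvalue b * B ⟨b, i⟩ q +
      if h : (i : ℕ) + 1 < J.size b then B ⟨b, ⟨i + 1, h⟩⟩ q else 0 := by
  rw [Matrix.mul_apply, Fintype.sum_sigma, Finset.sum_eq_single b,
    ← elementaryJordanMatrix_mulVec_apply (J.eigenvalue b) (fun k => B ⟨b, k⟩ q)]
  · simp [toMatrix, Matrix.blockDiagonal'_apply_eq]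
  · intro c _ hc
    exact Finset.sum_eq_zero fun k _ => by
      rw [toMatrix, Matrix.blockDiagonal'_apply_ne _ _ _ hc.symm, zero_mul]
  · simp

theorem mul_toMatrix_apply {m : Type*} (B : Matrix m J.Pos E) (p : m) (b : Fin J.numBlocks)
    (j : Fin (J.size b)) :
    (B * J.toMatrix) p ⟨b, j⟩ = B p ⟨b, j⟩ * J.eigenvalue b +
      if 0 < (j : ℕ) then B p ⟨b, ⟨j - 1, by omega⟩⟩ else 0 := by
  rw [Matrix.mul_apply, Fintype.sum_sigma, Finset.sum_eq_single b,
    ← elementaryJordanMatrix_vecMul_apply (J.eigenvalue b) (fun k => B p ⟨b, k⟩)]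
  · simp [toMatrix, Matrix.blockDiagonal'_apply_eq]
  · intro c _ hc
    exact Finset.sum_eq_zero fun k _ => by
      rw [toMatrix, Matrix.blockDiagonal'_apply_ne _ _ _ hc, mul_zero]
  · simp

/-- The entries of the block of `B` in position `(b, d)`, extended by zero. -/
def blockEntry (B : Matrix J.Pos J.Pos E) (b d : Fin J.numBlocks) (i j : ℕ) : E :=
  if h : i < J.size b ∧ j < J.size d then B ⟨b, ⟨i, h.1⟩⟩ ⟨d, ⟨j, h.2⟩⟩ else 0

theorem isJordanIntertwiner_blockEntry {B : Matrix J.Pos J.Pos E}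
    (hB : J.toMatrix * B = B * J.toMatrix) (b d : Fin J.numBlocks) :
    IsJordanIntertwiner (J.size b) (J.size d) (J.eigenvalue b) (J.eigenvalue d)
      (blockEntry B b d) where
  eq_zero i j h := dif_neg h
  rel i j hi hj := by
    have := congrFun (congrFun hB ⟨b, ⟨i, hi⟩⟩) ⟨d, ⟨j, hj⟩⟩
    rw [toMatrix_mul_apply, mul_toMatrix_apply] at this
    have hj' : j - 1 < J.size d := by omega
    simpa [blockEntry, hi, hj, hj'] using this

theorem blockEntry_eq (B : Matrix J.Pos J.Pos E) (p q : J.Pos) :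
    blockEntry B p.1 q.1 p.2 q.2 = B p q := by
  simp [blockEntry]

/-- These inequalities make `headHom` multiplicative and its common kernel triangular. -/
theorem of_apply_ne_zero {B : Matrix J.Pos J.Pos E} (hB : J.toMatrix * B = B * J.toMatrix)
    {p q : J.Pos} (hpq : B p q ≠ 0) :
    J.eigenvalue p.1 = J.eigenvalue q.1 ∧ (p.2 : ℕ) ≤ q.2 ∧
      J.size q.1 + p.2 ≤ J.size p.1 + q.2 := by
  have h := isJordanIntertwiner_blockEntry hB p.1 q.1
  rw [← blockEntry_eq B p q] at hpq
  have he : J.eigenvalue p.1 = J.eigenvalue q.1 := by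
    by_contra hne
    exact hpq (h.eq_zero_of_ne hne _ _)
  rw [he] at h
  refine ⟨he, ?_, ?_⟩
  · by_contra! hlt
    exact hpq (h.eq_zero_of_lt hlt)
  · by_contra! hlt
    exact hpq (h.eq_zero_of_add_lt hlt)

variable (J) in
/-- The first position of a block. -/
def first (b : Fin J.numBlocks) : J.Pos := ⟨b, ⟨0, J.size_pos b⟩⟩

theorem apply_eq_apply_first {B : Matrix J.Pos J.Pos E} (hB : J.toMatrix * B = B * J.toMatrix)
    {p q : J.Pos} (he : J.eigenvalue p.1 = J.eigenvalue q.1) (hpq : (p.2 : ℕ) = q.2) :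
    B p q = B (J.first p.1) (J.first q.1) := by
  have h := isJordanIntertwiner_blockEntry hB p.1 q.1
  rw [he] at h
  rw [← blockEntry_eq B p q, hpq, h.diag (hpq ▸ p.2.2) q.2.2]
  exact blockEntry_eq B (J.first p.1) (J.first q.1)

variable (J) in
/-- The blocks that are equal to the block `b`. -/
abbrev EqualBlocks (b : Fin J.numBlocks) : Type :=
  {c : Fin J.numBlocks // J.size c = J.size b ∧ J.eigenvalue c = J.eigenvalue b}

open Classical in
noncomputable instance (b : Fin J.numBlocks) : Fintype (J.EqualBlocks b) :=
  inferInstance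

variable (J) in
/-- The commutant of the Jordan matrix of `J`. -/
abbrev commutant : Subalgebra E (Matrix J.Pos J.Pos E) :=
  Subalgebra.centralizer E {J.toMatrix}

theorem mem_commutant {B : Matrix J.Pos J.Pos E} :
    B ∈ J.commutant ↔ J.toMatrix * B = B * J.toMatrix := by
  simp [Subalgebra.mem_centralizer_iff]

variable (J) in
/-- The action of the commutant on the multiplicity space of the block `b`. -/
noncomputable def headHom (b : Fin J.numBlocks) :
    J.commutant →ₐ[E] Matrix (J.EqualBlocks b) (J.EqualBlocks b) E :=
  AlgHom.ofLinearMap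
    { toFun := fun B => Matrix.of fun c d => B.1 (J.first c) (J.first d)
      map_add' := fun B C => rfl
      map_smul' := fun t B => rfl }
    (by
      ext c d
      have : J.first c = J.first d ↔ c = d :=
        ⟨fun h => Subtype.ext (congrArg Sigma.fst h), fun h => by rw [h]⟩
      change (1 : Matrix J.Pos J.Pos E) (J.first c) (J.first d) =
        (1 : Matrix (J.EqualBlocks b) (J.EqualBlocks b) E) c d
      simp only [Matrix.one_apply, this])
    (by
      intro B C
      ext c d
      have hB := mem_commutant.1 B.2
      have hC := mem_commutant.1 C.2
      -- A nonzero term through position `i` of block `y` forces `i = 0`, and the size of `y` is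
      -- squeezed between those of `d` and `c`, which agree.
      refine (Fintype.sum_of_injective (fun e : J.EqualBlocks b => J.first e) ?_ _ _ ?_ ?_).symm
      · exact fun e e' h => Subtype.ext (congrArg Sigma.fst h)
      · rintro ⟨y, i⟩ hy
        by_contra hne
        have h1 := of_apply_ne_zero hB (left_ne_zero_of_mul hne)
        have h2 := of_apply_ne_zero hC (right_ne_zero_of_mul hne)
        have hc := c.2
        have hd := d.2
        simp only [first] at h1 h2
        refine hy ⟨⟨y, by omega, h2.1.trans hd.2⟩, ?_⟩
        exact Sigma.ext rfl (heq_of_eq (Fin.ext (show 0 = (i : ℕ) by omega)))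
      · intro e
        rfl)

theorem headHom_apply (b : Fin J.numBlocks) (B : J.commutant) (c d : J.EqualBlocks b) :
    J.headHom b B c d = B.1 (J.first c) (J.first d) := rfl

theorem headHom_surjective (b : Fin J.numBlocks) : Function.Surjective (J.headHom b) := by
  classical
  intro M
  let P : Fin J.numBlocks → Prop := fun c =>
    J.size c = J.size b ∧ J.eigenvalue c = J.eigenvalue b
  -- Each entry of `M` becomes a scalar matrix between two equal blocks.
  let B : Matrix J.Pos J.Pos E := Matrix.of fun p q =>
    if h : (P p.1 ∧ P q.1) ∧ (p.2 : ℕ) = q.2 then M ⟨p.1, h.1.1⟩ ⟨q.1, h.1.2⟩ else 0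
  have hB : J.toMatrix * B = B * J.toMatrix := by
    ext ⟨c, i⟩ ⟨d, j⟩
    rw [toMatrix_mul_apply, mul_toMatrix_apply]
    by_cases h : P c ∧ P d
    · have hs : J.size c = J.size d := h.1.1.trans h.2.1.symm
      have hij : ((i : ℕ) + 1 < J.size c ∧ (i : ℕ) + 1 = j) ↔ (0 < (j : ℕ) ∧ (i : ℕ) = j - 1) := by
        omega
      simp only [B, Matrix.of_apply, h.1.2, h.2.2, mul_comm _ (J.eigenvalue b)]
      congr 1
      by_cases h' : (0 < (j : ℕ) ∧ (i : ℕ) = j - 1)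
      · have h'' := hij.2 h'
        rw [dif_pos h''.1, dif_pos ⟨h, h''.2⟩, if_pos h'.1, dif_pos ⟨h, h'.2⟩]
      · have h'' := fun hh => h' (hij.1 hh)
        simp only [h, true_and]
        split_ifs <;> first | rfl | (exfalso; tauto)
    · simp [B, h]
  refine ⟨⟨B, mem_commutant.2 hB⟩, ?_⟩
  ext c d
  rw [headHom_apply]
  exact dif_pos ⟨⟨c.2, d.2⟩, rfl⟩

variable (J) in
/-- A weight on the positions for which the radical of the commutant is strictly triangular. -/
def weight (p : J.Pos) : ℕ :=
  p.2 * (∑ b, J.size b) + (∑ b, J.size b - J.size p.1)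

/-- The weight is lexicographic: position in the block, then decreasing block size (sizes are
positive, so the second term stays below the multiplier). A tie would be an entry of some `headHom`,
which vanishes. -/
theorem weight_lt_of_apply_ne_zero {B : J.commutant} (h : ∀ b, J.headHom b B = 0) {p q : J.Pos}
    (hpq : B.1 p q ≠ 0) : J.weight p < J.weight q := by
  have hB := mem_commutant.1 B.2
  obtain ⟨he, hle, hs⟩ := of_apply_ne_zero hB hpq
  have hmax : ∀ b, J.size b ≤ ∑ b, J.size b := fun b =>
    Finset.single_le_sum (fun _ _ => Nat.zero_le _) (Finset.mem_univ b)
  have hp := hmax p.1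
  have hq := hmax q.1
  have hp0 := J.size_pos p.1
  simp only [weight]
  generalize (∑ b, J.size b) = M at *
  rcases hle.lt_or_eq with hlt | heq
  · have : ((p.2 : ℕ) + 1) * M ≤ q.2 * M := Nat.mul_le_mul_right _ hlt
    rw [add_mul, one_mul] at this
    omega
  · rw [heq] at hs ⊢
    rcases (show J.size q.1 ≤ J.size p.1 by omega).lt_or_eq with hlt | hse
    · omega
    · refine absurd ?_ hpq
      rw [apply_eq_apply_first hB he heq]
      have := congrFun (congrFun (h q.1) ⟨p.1, hse.symm, he⟩) ⟨q.1, rfl, rfl⟩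
      rwa [headHom_apply] at this

end JordanData

end JordanCommutant

/-! ### Extension of scalars -/

section ScalarExtension

variable {K : Type*} [Field K] {E : Type*} [Field E] [Algebra K E]

/-- This allows a multilinear identity over `K` to pass to `E`-spans. -/
theorem IsMultilinearPolynomial.exists_multilinearMap {f : FreeAlgebra K ℕ}
    (hf : IsMultilinearPolynomial K f) (R : Type*) [Ring R] [Algebra K R] [Algebra E R]
    [IsScalarTower K E R] :
    ∃ (d : ℕ) (F : MultilinearMap E (fun _ : Fin d => R) R),
      ∀ a : ℕ → R, FreeAlgebra.lift K a f = F fun i => a i := by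
  obtain ⟨d, c, rfl⟩ := hf
  refine ⟨d, ∑ σ : Equiv.Perm (Fin d), algebraMap K E (c σ) •
    (MultilinearMap.mkPiAlgebraFin E d R).domDomCongr σ, fun a => ?_⟩
  simp [map_list_prod, List.map_ofFn, Function.comp_def]

theorem MultilinearMap.eq_zero_of_mem_span {d : ℕ} {R N : Type*} [AddCommGroup R] [Module E R]
    [AddCommGroup N] [Module E N] (F : MultilinearMap E (fun _ : Fin d => R) N) {s : Set R}
    (hF : ∀ a : Fin d → R, (∀ i, a i ∈ s) → F a = 0) (a : Fin d → R)
    (ha : ∀ i, a i ∈ Submodule.span E s) : F a = 0 := by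
  -- The slots are released from `s` to its span one at a time.
  suffices H : ∀ (T : Finset (Fin d)) (a : Fin d → R), (∀ i ∈ T, a i ∈ Submodule.span E s) →
      (∀ i ∉ T, a i ∈ s) → F a = 0 from
    H Finset.univ a (fun i _ => ha i) fun i hi => absurd (Finset.mem_univ i) hi
  intro T
  induction T using Finset.induction_on with
  | empty => exact fun a _ h => hF a fun i => h i (Finset.notMem_empty i)
  | insert j T hj ih =>
    intro a h1 h2
    have : Submodule.span E s ≤ LinearMap.ker (F.toLinearMap a j) := by
      refine Submodule.span_le.2 fun x hx => ?_
      refine ih _ (fun i hi => ?_) fun i hi => ?_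
      · rw [Function.update_of_ne (ne_of_mem_of_not_mem hi hj)]
        exact h1 i (Finset.mem_insert_of_mem hi)
      · by_cases hij : i = j
        · subst hij
          simpa using hx
        · rw [Function.update_of_ne hij]
          exact h2 i (by simp [hij, hi])
    simpa using this (h1 j (Finset.mem_insert_self j T))

theorem lift_eq_zero_of_mem_span {f : FreeAlgebra K ℕ} (hf : IsMultilinearPolynomial K f)
    {R : Type*} [Ring R] [Algebra K R] [Algebra E R] [IsScalarTower K E R] {s : Set R}
    (hs : s.Nonempty) (h : ∀ a : ℕ → R, (∀ i, a i ∈ s) → FreeAlgebra.lift K a f = 0)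
    (a : ℕ → R) (ha : ∀ i, a i ∈ Submodule.span E s) : FreeAlgebra.lift K a f = 0 := by
  obtain ⟨d, F, hF⟩ := hf.exists_multilinearMap (E := E) R
  obtain ⟨x, hx⟩ := hs
  rw [hF]
  refine F.eq_zero_of_mem_span (fun b hb => ?_) _ fun i => ha i
  have := h (fun n => if hn : n < d then b ⟨n, hn⟩ else x) fun n => by
    split_ifs
    exacts [hb _, hx]
  rw [hF] at this
  simpa using this

/-- Since `A` has entries in `K`, each coordinate matrix of `B` in a `K`-basis of `E` commutes with
`A`. -/
theorem Matrix.mem_span_map_centralizer {n : Type*} [Fintype n] [DecidableEq n]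
    {A : Matrix n n K} {B : Matrix n n E}
    (hB : A.map (algebraMap K E) * B = B * A.map (algebraMap K E)) :
    B ∈ Submodule.span E
      ((fun X : Matrix n n K => X.map (algebraMap K E)) '' {X | A * X = X * A}) := by
  classical
  let b := Module.Basis.ofVectorSpace K E
  have hcomm : ∀ t, A * B.map (b.coord t) = B.map (b.coord t) * A := fun t => by
    ext i j
    have := congrArg (b.coord t) (congrFun (congrFun hB i) j)
    simp only [Matrix.mul_apply, map_sum, Matrix.map_apply] at this ⊢
    calc _ = _ := Finset.sum_congr rfl fun k _ => by
            rw [← Algebra.smul_def, map_smul, smul_eq_mul]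
      _ = _ := this
      _ = _ := Finset.sum_congr rfl fun k _ => by
            rw [mul_comm, ← Algebra.smul_def, map_smul, smul_eq_mul, mul_comm]
  let T : Finset _ := Finset.univ.biUnion fun i => Finset.univ.biUnion fun j =>
    (b.repr (B i j)).support
  have hsum : B = ∑ t ∈ T, b t • (B.map (b.coord t)).map (algebraMap K E) := by
    ext i j
    rw [Matrix.sum_apply]
    conv_lhs => rw [← b.linearCombination_repr (B i j), Finsupp.linearCombination_apply,
      Finsupp.sum_of_support_subset (s := T) _ (fun t ht => by
        simp only [T, Finset.mem_biUnion]
        exact ⟨i, Finset.mem_univ _, j, Finset.mem_univ _, ht⟩) _ (by simp)]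
    refine Finset.sum_congr rfl fun t _ => ?_
    simp [Algebra.smul_def, mul_comm]
  rw [hsum]
  exact Submodule.sum_mem _ fun t _ => Submodule.smul_mem _ _
    (Submodule.subset_span ⟨_, hcomm t, rfl⟩)

end ScalarExtension

/-! ### Existence of the Jordan form -/

section JordanForm

open Polynomial

universe u

variable {E : Type u} [Field E]

/-- Taylor shift by `μ` turns a relation into a polynomial of degree below `e` divisible by `X ^ e`.
-/
theorem linearIndependent_mkQ_X_sub_C_pow (μ : E) (e : ℕ) :
    LinearIndependent E fun k : Fin e =>
      (Submodule.span E[X] {(X - C μ) ^ e}).mkQ ((X - C μ) ^ (k : ℕ)) := by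
  rw [Fintype.linearIndependent_iff]
  intro c hc
  set g : E[X] := ∑ k : Fin e, c k • X ^ (k : ℕ) with hg
  have hmem : ∑ k : Fin e, c k • (X - C μ) ^ (k : ℕ) ∈
      Submodule.span E[X] {(X - C μ) ^ e} := by
    rw [← Submodule.Quotient.mk_eq_zero, ← Submodule.mkQ_apply, map_sum, ← hc]
    refine Finset.sum_congr rfl fun k _ => ?_
    rw [Submodule.mkQ_apply, Submodule.mkQ_apply, Submodule.Quotient.mk_smul]
  obtain ⟨r, hr⟩ := Submodule.mem_span_singleton.1 hmem
  have htaylor : g = taylor μ r * X ^ e := by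
    have := congrArg (taylor μ) hr
    simp only [smul_eq_mul, taylor_mul, taylor_pow, map_sum, map_smul, taylor_X, taylor_C, map_sub,
      add_sub_cancel_right] at this
    exact this.symm
  intro k
  have h1 : g.coeff k = c k := by
    rw [hg, finsetSum_coeff, Finset.sum_eq_single k]
    · simp
    · intro l _ hl
      simp [coeff_X_pow, Fin.val_inj, hl.symm]
    · simp
  rw [← h1, htaylor, coeff_mul_X_pow', if_neg (by omega)]

theorem exists_basis_quotient_X_sub_C_pow (μ : E) (e : ℕ) :
    ∃ b : Module.Basis (Fin e) E (E[X] ⧸ Submodule.span E[X] {(X - C μ) ^ e}),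
      ∀ j, (X : E[X]) • b j = μ • b j + if 0 < (j : ℕ) then b ⟨j - 1, by omega⟩ else 0 := by
  -- With the powers in reverse order, `X - μ` lowers the index, which puts the ones above the
  -- diagonal.
  have hli := (linearIndependent_mkQ_X_sub_C_pow μ e).comp Fin.rev Fin.rev_injective
  have hfr : Module.finrank E (E[X] ⧸ Submodule.span E[X] {(X - C μ) ^ e}) = e :=
    finrank_quotient_span_eq_natDegree.trans (by simp)
  have : Module.Finite E (E[X] ⧸ Submodule.span E[X] {(X - C μ) ^ e}) :=
    ((monic_X_sub_C μ).pow e).finite_quotient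
  have hsp := hli.span_eq_top_of_card_eq_finrank' (by simp [hfr])
  refine ⟨Module.Basis.mk hli hsp.ge, fun j => ?_⟩
  have hb : ∀ i, Module.Basis.mk hli hsp.ge i =
      (Submodule.span E[X] {(X - C μ) ^ e}).mkQ ((X - C μ) ^ (e - 1 - i : ℕ)) := fun i => by
    rw [Module.Basis.mk_apply, Function.comp_apply, Fin.val_rev]
    congr 2
    omega
  have hX : (X : E[X]) • (Submodule.span E[X] {(X - C μ) ^ e}).mkQ ((X - C μ) ^ (e - 1 - j : ℕ)) =
      μ • (Submodule.span E[X] {(X - C μ) ^ e}).mkQ ((X - C μ) ^ (e - 1 - j : ℕ)) +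
      (Submodule.span E[X] {(X - C μ) ^ e}).mkQ ((X - C μ) ^ (e - 1 - j + 1 : ℕ)) := by
    rw [← map_smul, Submodule.mkQ_apply, Submodule.mkQ_apply, Submodule.mkQ_apply,
      ← Submodule.Quotient.mk_smul, ← Submodule.Quotient.mk_add]
    congr 1
    rw [smul_eq_mul, Polynomial.smul_eq_C_mul]
    ring
  rw [hb, hX]
  congr 1
  split_ifs with hj
  · rw [hb]
    congr 2
    simp only
    omega
  · rw [Submodule.mkQ_apply, Submodule.Quotient.mk_eq_zero,
      show e - 1 - (j : ℕ) + 1 = e by omega]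
    exact Submodule.mem_span_singleton_self _

theorem exists_basis_quotient_irreducible_pow [IsAlgClosed E] {p : E[X]} (hp : Irreducible p)
    (e : ℕ) :
    ∃ (μ : E) (b : Module.Basis (Fin e) E (E[X] ⧸ Submodule.span E[X] {p ^ e})),
      ∀ j, (X : E[X]) • b j = μ • b j + if 0 < (j : ℕ) then b ⟨j - 1, by omega⟩ else 0 := by
  obtain ⟨μ, hμ⟩ := IsAlgClosed.exists_root p
    (by rw [IsAlgClosed.degree_eq_one_of_irreducible E hp]; exact one_ne_zero)
  have hass : Associated (X - C μ) p :=
    (irreducible_X_sub_C μ).associated_of_dvd hp (dvd_iff_isRoot.2 hμ)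
  have hspan : Submodule.span E[X] {p ^ e} = Submodule.span E[X] {(X - C μ) ^ e} :=
    Ideal.span_singleton_eq_span_singleton.2 hass.symm.pow_pow
  rw [hspan]
  exact ⟨μ, exists_basis_quotient_X_sub_C_pow μ e⟩

/-- This is the structure theorem for torsion modules over `E[X]`; blocks of size zero are still
allowed. -/
theorem Module.End.exists_jordan_basis [IsAlgClosed E] {V : Type*} [AddCommGroup V] [Module E V]
    [FiniteDimensional E V] (T : Module.End E V) :
    ∃ (ι : Type u) (_ : Fintype ι) (e : ι → ℕ) (μ : ι → E)
      (b : Module.Basis (Σ i, Fin (e i)) E V), ∀ i (j : Fin (e i)),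
        T (b ⟨i, j⟩) = μ i • b ⟨i, j⟩ +
          if 0 < (j : ℕ) then b ⟨i, ⟨j - 1, by omega⟩⟩ else 0 := by
  classical
  have htors : Module.IsTorsion E[X] (Module.AEval' T) := by
    intro x
    refine ⟨⟨minpoly E T, mem_nonZeroDivisors_of_ne_zero
      (minpoly.ne_zero (Algebra.IsIntegral.isIntegral T))⟩, ?_⟩
    have := Module.AEval.of_aeval_smul T (minpoly E T) ((Module.AEval'.of T).symm x)
    rw [minpoly.aeval, zero_smul, map_zero] at this
    simpa using this.symm
  obtain ⟨ι, _, p, hp, e, ⟨φ⟩⟩ := Module.equiv_directSum_of_isTorsion htors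
  choose μ b hb using fun i => exists_basis_quotient_irreducible_pow (hp i) (e i)
  let B := (DFinsupp.basis b).map
    ((φ.restrictScalars E).symm.trans (Module.AEval'.of T).symm)
  have hB : ∀ i j, B ⟨i, j⟩ =
      (Module.AEval'.of T).symm (φ.symm (DirectSum.lof E[X] ι _ i (b i j))) := fun i j => by
    simp only [B, Module.Basis.map_apply]
    rw [show DFinsupp.basis b ⟨i, j⟩ = DFinsupp.single i (b i j) from ?_]
    · rfl
    · apply (DFinsupp.basis b).repr.injective
      rw [Module.Basis.repr_self]
      ext ⟨k, l⟩
      by_cases hk : i = k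
      · subst hk
        simp [DFinsupp.basis, Finsupp.single_apply]
      · simp [DFinsupp.basis, hk]
  refine ⟨ι, inferInstance, e, μ, B, fun i j => ?_⟩
  apply (Module.AEval'.of T).injective
  rw [← Module.AEval'.X_smul_of, map_add, map_smul, hB, LinearEquiv.apply_symm_apply, ← map_smul,
    ← map_smul, hb, map_add, map_add]
  congr 1
  · rw [LinearMap.map_smul_of_tower]
    exact (φ.restrictScalars E).symm.map_smul _ _
  · split_ifs
    · rw [hB, LinearEquiv.apply_symm_apply]
    · simp

theorem exists_isJordanFormOf [IsAlgClosed E] {n : ℕ} (A : Matrix (Fin n) (Fin n) E) :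
    ∃ J : JordanData E, J.IsJordanFormOf A := by
  classical
  obtain ⟨ι, _, e, μ, b, hb⟩ := Module.End.exists_jordan_basis (Matrix.toLin' A)
  -- Summands with exponent zero contribute no basis vector and are discarded.
  let c : Fin (Fintype.card {i // 0 < e i}) ≃ {i // 0 < e i} := (Fintype.equivFin _).symm
  let J : JordanData E :=
    { numBlocks := _
      size := fun k => e (c k)
      size_pos := fun k => (c k).2
      eigenvalue := fun k => μ (c k) }
  let g : J.Pos → Σ i, Fin (e i) := fun p => ⟨c p.1, p.2⟩
  have hg : Function.Bijective g := by
    constructor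
    · rintro ⟨k, i⟩ ⟨l, j⟩ h
      have hkl : k = l := c.injective (Subtype.ext (congrArg Sigma.fst h))
      subst hkl
      simpa [g] using h
    · rintro ⟨i, j⟩
      obtain ⟨k, hk⟩ := c.surjective ⟨i, by have := j.2; omega⟩
      have hk' : (c k : ι) = i := congrArg Subtype.val hk
      subst hk'
      exact ⟨⟨k, j⟩, rfl⟩
  let v : Module.Basis J.Pos E (Fin n → E) := b.reindex (Equiv.ofBijective g hg).symm
  have hvg : ∀ p, v p = b (g p) := fun p => by simp [v]
  let s := Pi.basisFun E (Fin n)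
  refine ⟨J, s.toMatrix v, v.toMatrix s, s.toMatrix_mul_toMatrix_flip v,
    v.toMatrix_mul_toMatrix_flip s, ?_⟩
  have key : A * s.toMatrix v = s.toMatrix v * J.toMatrix := by
    ext i ⟨k, j⟩
    rw [JordanData.mul_toMatrix_apply]
    have := congrFun (hb (c k) j) i
    rw [Matrix.toLin'_apply] at this
    simp only [Matrix.mul_apply, Module.Basis.toMatrix_apply, hvg, s, Pi.basisFun_repr, g]
    simp only [Matrix.mulVec, dotProduct] at this
    rw [this]
    by_cases hj : 0 < (j : ℕ)
    · simp [J, hj, mul_comm]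
    · simp [J, hj, mul_comm]
  rw [Matrix.mul_assoc, key, ← Matrix.mul_assoc, v.toMatrix_mul_toMatrix_flip s, Matrix.one_mul]

end JordanForm

/-! ### Identities of the centralizer -/

section Centralizer

variable {K : Type*} [Field K] {E : Type*} [Field E] [Algebra K E]

/-- M_q(K) embeds in M_q(E), whose elements lift to the commutant along `headHom`. -/
theorem JordanData.isPolynomialIdentity_headHom {J : JordanData E} {f : FreeAlgebra K ℕ}
    (hf : IsPolynomialIdentity K J.commutant f) (b : Fin J.numBlocks) {q : ℕ}
    (hq : Fintype.card (J.EqualBlocks b) = q) :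
    IsPolynomialIdentity K (Matrix (Fin q) (Fin q) K) f := by
  intro a
  let g : Fin q ≃ J.EqualBlocks b := (Fintype.equivFinOfCardEq hq).symm
  let ψ : Matrix (Fin q) (Fin q) K →ₐ[K] Matrix (J.EqualBlocks b) (J.EqualBlocks b) E :=
    (Matrix.reindexAlgEquiv K E g).toAlgHom.comp (Algebra.ofId K E).mapMatrix
  have hψ : Function.Injective ψ :=
    (Matrix.reindexAlgEquiv K E g).injective.comp
      (Matrix.map_injective (algebraMap K E).injective)
  choose c hc using fun i => J.headHom_surjective b (ψ (a i))
  apply hψ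
  rw [← lift_algHom_apply ψ, map_zero]
  simp only [← hc]
  have := lift_algHom_apply ((J.headHom b).restrictScalars K) c f
  rw [hf c, map_zero] at this
  exact this

/-- A product of sufficiently many generalised Capelli polynomials vanishes on the commutant. -/
theorem JordanData.exists_isPolynomialIdentity_capelliProduct (J : JordanData E) {p m : ℕ}
    (hp : ∀ b, Fintype.card (J.EqualBlocks b) ≤ p) (hm : p ^ 2 < m) :
    ∃ k, IsPolynomialIdentity K J.commutant (capelliProduct K m k) := by
  have hstep : ∀ (a : ℕ → J.commutant) (s : ℕ) (b : Fin J.numBlocks),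
      J.headHom b (FreeAlgebra.lift K a (capelliPolynomial K m s)) = 0 := by
    intro a s b
    have := lift_algHom_apply ((J.headHom b).restrictScalars K) a (capelliPolynomial K m s)
    rw [AlgHom.restrictScalars_apply] at this
    rw [← this]
    refine lift_capelliPolynomial_eq_zero E ?_ _ _
    rw [Module.finrank_matrix, Module.finrank_self, mul_one]
    have := Nat.mul_le_mul (hp b) (hp b)
    rw [sq] at hm
    omega
  -- Each Capelli factor raises the weight by at least one, so more factors than the largest weight
  -- give zero.
  have hprod : ∀ (a : ℕ → J.commutant) (k : ℕ) (p q : J.Pos),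
      (FreeAlgebra.lift K a (capelliProduct K m k)).1 p q ≠ 0 → J.weight p + k ≤ J.weight q := by
    intro a k
    induction k with
    | zero =>
      intro p q h
      by_cases hpq : p = q
      · rw [hpq, add_zero]
      · simp [capelliProduct, hpq] at h
    | succ k ih =>
      intro p q h
      rw [capelliProduct, map_mul] at h
      obtain ⟨r, -, hr⟩ := Finset.exists_ne_zero_of_sum_ne_zero h
      have h1 := ih p r (left_ne_zero_of_mul hr)
      have h2 := JordanData.weight_lt_of_apply_ne_zero (hstep a _) (right_ne_zero_of_mul hr)
      omega
  refine ⟨Finset.univ.sup J.weight + 1, fun a => ?_⟩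
  ext p q
  by_contra h
  have h1 := hprod a _ p q h
  have h2 := Finset.le_sup (f := J.weight) (Finset.mem_univ q)
  omega

variable {n : ℕ} {A : Matrix (Fin n) (Fin n) K} {J : JordanData E}

/-- The centralizer of a matrix and the commutant of its Jordan form have the same multilinear
identities over the base field. -/
theorem JordanData.IsJordanFormOf.isPolynomialIdentity_iff
    (hJ : J.IsJordanFormOf (A.map (algebraMap K E))) {f : FreeAlgebra K ℕ}
    (hf : IsMultilinearPolynomial K f) :
    IsPolynomialIdentity K (Subalgebra.centralizer K ({A} : Set (Matrix (Fin n) (Fin n) K))) f ↔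
      IsPolynomialIdentity K J.commutant f := by
  obtain ⟨P, Q, hPQ, hQP, hA⟩ := hJ
  set A' := A.map (algebraMap K E) with hA'
  have hcancel : ∀ {m : Type} (X : Matrix J.Pos m E), Q * (P * X) = X := fun X => by
    rw [← Matrix.mul_assoc, hQP, Matrix.one_mul]
  have hcancel' : ∀ {m : Type} (X : Matrix (Fin n) m E), P * (Q * X) = X := fun X => by
    rw [← Matrix.mul_assoc, hPQ, Matrix.one_mul]
  let conj : Matrix (Fin n) (Fin n) E →ₐ[K] Matrix J.Pos J.Pos E :=
    AlgHom.ofLinearMap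
      { toFun := fun X => Q * X * P
        map_add' := fun X Y => by rw [Matrix.mul_add, Matrix.add_mul]
        map_smul' := fun t X => by simp }
      (by simp [hQP])
      (by intro X Y; simp [Matrix.mul_assoc, hcancel'])
  have hconj : ∀ X, conj X = Q * X * P := fun X => rfl
  have hinj : Function.Injective conj := fun X Y h => by
    have := congrArg (fun Z => P * Z * Q) h
    simpa [hconj, Matrix.mul_assoc, hcancel', hPQ] using this
  have hcomm : ∀ X, A' * X = X * A' ↔ conj X ∈ J.commutant := fun X => by
    rw [JordanData.mem_commutant, ← hA, ← hconj, ← map_mul, ← map_mul, hinj.eq_iff]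
  have hmap : ∀ X : Matrix (Fin n) (Fin n) K, A * X = X * A →
      A' * (X.map (algebraMap K E)) = X.map (algebraMap K E) * A' := fun X hX => by
    rw [hA', ← Matrix.map_mul, hX, Matrix.map_mul]
  constructor
  -- Undoing the conjugation puts the arguments in the `E`-span of the centralizer over `K`, where
  -- multilinearity applies.
  · intro h a
    apply Subtype.ext
    rw [← Subalgebra.coe_val, ← AlgHom.restrictScalars_apply K, ← lift_algHom_apply]
    have hY : ∀ i, conj (P * (a i).1 * Q) = (a i).1 := fun i => by
      simp [hconj, Matrix.mul_assoc, hcancel, hQP]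
    have := lift_algHom_apply conj (fun i => P * (a i).1 * Q) f
    simp only [hY] at this
    refine this.trans ?_
    rw [lift_eq_zero_of_mem_span (E := E) hf (s := (fun X : Matrix (Fin n) (Fin n) K =>
      X.map (algebraMap K E)) '' {X | A * X = X * A}) ⟨_, 0, by simp, rfl⟩ _ _ fun i =>
        Matrix.mem_span_map_centralizer ((hcomm _).2 (by rw [hY]; exact (a i).2))]
    · simp
    · intro c hc
      choose d hd hdc using hc
      have := lift_algHom_apply (((Algebra.ofId K E).mapMatrix (m := Fin n)).comp
        (Subalgebra.centralizer K ({A} : Set (Matrix (Fin n) (Fin n) K))).val)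
        (fun i => ⟨d i, by simpa [Subalgebra.mem_centralizer_iff] using hd i⟩) f
      rw [h, map_zero] at this
      rw [← this]
      congr 2
      ext1 i
      exact (hdc i).symm
  -- Here the centralizer simply embeds in the commutant.
  · intro h a
    apply Subtype.ext
    apply Matrix.map_injective (algebraMap K E).injective
    apply hinj
    have h1 := lift_algHom_apply (conj.comp (((Algebra.ofId K E).mapMatrix (m := Fin n)).comp
        (Subalgebra.centralizer K ({A} : Set (Matrix (Fin n) (Fin n) K))).val)) a f
    have hmem : ∀ i, conj ((a i).1.map (algebraMap K E)) ∈ J.commutant := fun i =>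
      (hcomm _).1 (hmap _ ((Subalgebra.mem_centralizer_iff K).1 (a i).2 A rfl))
    have h2 := lift_algHom_apply (J.commutant.val.restrictScalars K)
      (fun i => ⟨conj ((a i).1.map (algebraMap K E)), hmem i⟩) f
    rw [h, map_zero] at h2
    refine (h1.symm.trans h2).trans ?_
    simp

theorem JordanData.maxEqualBlocks_eq_sup_card {F : Type*} (J : JordanData F) :
    J.maxEqualBlocks = Finset.univ.sup fun b => Fintype.card (J.EqualBlocks b) := by
  rw [maxEqualBlocks]
  congr 1
  ext b
  rw [← Fintype.card_subtype]

end Centralizer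

/-! ### The theorem -/

theorem corollary6p2 {K : Type*} [Field K] {E : Type*} [Field E] [Algebra K E] [IsAlgClosure K E]
    (n : ℕ) (A : Matrix (Fin n) (Fin n) K) :
    (∃ J : JordanData E, J.IsJordanFormOf (A.map (algebraMap K E))) ∧
    ∀ J : JordanData E, J.IsJordanFormOf (A.map (algebraMap K E)) →
      IsPIDegree K (Subalgebra.centralizer K ({A} : Set (Matrix (Fin n) (Fin n) K)))
        J.maxEqualBlocks := by
  classical
  have : IsAlgClosed E := IsAlgClosure.isAlgClosed K
  refine ⟨exists_isJordanFormOf _, fun J hJ => ⟨?_, ?_⟩⟩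
  · refine followsFrom_multilinearIdentities_iff.2 fun f hf => ?_
    have hfJ := (hJ.isPolynomialIdentity_iff hf.1).1 hf.2
    rcases Nat.eq_zero_or_pos J.numBlocks with h0 | hpos
    · have : IsEmpty (Fin J.numBlocks) := by rw [h0]; infer_instance
      have hz : J.maxEqualBlocks = 0 := by simp [JordanData.maxEqualBlocks]
      rw [hz]
      -- M_0(K) is the zero ring and satisfies every identity.
      exact fun a => Subsingleton.elim _ _
    · obtain ⟨b, -, hb⟩ := Finset.exists_mem_eq_sup (Finset.univ : Finset (Fin J.numBlocks))
        ⟨⟨0, hpos⟩, Finset.mem_univ _⟩ fun b => Fintype.card (J.EqualBlocks b)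
      exact JordanData.isPolynomialIdentity_headHom hfJ b
        (hb.symm.trans J.maxEqualBlocks_eq_sup_card.symm)
  · intro q hq
    by_contra! hlt
    have hq' := followsFrom_multilinearIdentities_iff.1 hq
    obtain ⟨k, hk⟩ := J.exists_isPolynomialIdentity_capelliProduct (K := K)
      (p := J.maxEqualBlocks) (m := J.maxEqualBlocks ^ 2 + 1) (fun b => by
        rw [J.maxEqualBlocks_eq_sup_card]
        exact Finset.le_sup (f := fun b => Fintype.card (J.EqualBlocks b)) (Finset.mem_univ b))
      (Nat.lt_succ_self _)
    have hml := isMultilinearPolynomial_capelliProduct (K := K) (J.maxEqualBlocks ^ 2 + 1) k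
    refine capelliProduct_not_identity (K := K) (q := q) (Nat.pow_lt_pow_left hlt two_ne_zero)
      (by omega) k (hq' _ ⟨hml, (hJ.isPolynomialIdentity_iff hml).2 hk⟩)
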